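/- For $0<y<\tfrac12$ and $j\in\mathbb Z$ let $a_j(\theta)=\dfrac{e^{ij\theta}}{\sqrt{2\pi y}}$, $\theta\in[-\pi y,\pi y]$, and for a finite set $T\subset\mathbb Z$ let $A_T:\mathbb C^{T}\to L^2([-\pi y,\pi y])$ be the operator $A_Tx=\sum_{j\in T}x_j a_j$ (the matrix with continuous row index $\theta$ and columns $a_j$, $j\in T$), where $\mathbb C^T$ carries the Euclidean norm. Let $\sigma_{\min}(A_T)$ be the least singular value of $A_T$, i.e. the square root of the smallest eigenvalue of $A_T^*A_T$. Write $c(y)=\sin(\pi y/2)$. Then there exists a constant $C>0$, independent of $y$ and $n$, such that for all $0<y<\tfrac12$ and all integers $n\ge 0$, with $T=\{0,1,\dots,n\}$, $$C\left(\frac{c(y)}{4}\right)^{n}\;\le\;\sigma_{\min}(A_T)\;\le\;4\,c(y)^{n}.$$ -/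

import Mathlib

open MeasureTheory

namespace Superres

noncomputable section

/-- The atom `a_j(θ) = e^{ijθ} / √(2πy)` as a function of `θ`. -/
def atomFun (y : ℝ) (j : ℤ) (θ : ℝ) : ℂ :=
  Complex.exp (Complex.I * (j : ℂ) * (θ : ℂ)) / (Real.sqrt (2 * Real.pi * y) : ℂ)

/-- The observation band `[-πy, πy]`. -/
def band (y : ℝ) : Set ℝ := Set.Icc (-(Real.pi * y)) (Real.pi * y)

/-- The complex Hilbert space `L²([-πy, πy])` (Lebesgue measure). -/
abbrev BandL2 (y : ℝ) : Type := Lp ℂ 2 (volume.restrict (band y))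

theorem memLp_atomFun (y : ℝ) (j : ℤ) :
    MemLp (atomFun y j) 2 (volume.restrict (band y)) := by
  have hc : Continuous (atomFun y j) := by
    unfold atomFun
    fun_prop
  have : IsFiniteMeasure (volume.restrict (band y)) := by
    unfold band
    infer_instance
  refine MemLp.of_bound hc.aestronglyMeasurable (1 / Real.sqrt (2 * Real.pi * y))
    (Filter.Eventually.of_forall fun θ => ?_)
  have h : Complex.I * (j : ℂ) * (θ : ℂ) = (((j : ℝ) * θ : ℝ) : ℂ) * Complex.I := by
    push_cast
    ring
  rw [atomFun, h, norm_div, Complex.norm_exp_ofReal_mul_I, Complex.norm_real,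
    Real.norm_of_nonneg (Real.sqrt_nonneg _)]

/-- The atom `a_j` as an element of `L²([-πy, πy])`. -/
def atom (y : ℝ) (j : ℤ) : BandL2 y := (memLp_atomFun y j).toLp (atomFun y j)

/-- The matrix `A_T` with continuous row index `θ ∈ [-πy, πy]` and columns `a_j`, `j ∈ T`:
the operator `x ↦ ∑_{j ∈ T} x_j a_j` from `ℂ^T` (Euclidean norm) to `L²([-πy, πy])`. -/
def matA (y : ℝ) (T : Finset ℤ) : EuclideanSpace ℂ T →L[ℂ] BandL2 y :=
  ∑ j : T, (EuclideanSpace.proj j : EuclideanSpace ℂ T →L[ℂ] ℂ).smulRight (atom y j)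

theorem matA_apply (y : ℝ) (T : Finset ℤ) (x : EuclideanSpace ℂ T) :
    matA y T x = ∑ j : T, x j • atom y (j : ℤ) := by
  simp [matA]

section SingularValues

variable {E F : Type*}
  [NormedAddCommGroup E] [InnerProductSpace ℂ E] [CompleteSpace E]
  [NormedAddCommGroup F] [InnerProductSpace ℂ F] [CompleteSpace F]

/-- The singular values of an operator `A` with finite-dimensional domain: the nonnegative square
roots of the eigenvalues of `A* A`. -/
def singularValueSet (A : E →L[ℂ] F) : Set ℝ :=
  {s : ℝ | 0 ≤ s ∧
    Module.End.HasEigenvalue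
      ((ContinuousLinearMap.adjoint A ∘L A : E →L[ℂ] E) : Module.End ℂ E) ((s : ℂ) ^ 2)}

/-- The least singular value `σ_min(A)`. -/
def sigmaMin (A : E →L[ℂ] F) : ℝ := sInf (singularValueSet A)

/-- For a nonzero finite-dimensional domain, `sigmaMin A` is indeed the smallest singular value. -/
theorem isLeast_sigmaMin [FiniteDimensional ℂ E] [Nontrivial E] (A : E →L[ℂ] F) :
    IsLeast (singularValueSet A) (sigmaMin A) := by
  have hfin : (singularValueSet A).Finite := by
    refine Set.Finite.of_finite_image (f := fun s : ℝ => (s : ℂ) ^ 2) ?_ ?_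
    · refine (Module.End.finite_hasEigenvalue
        ((ContinuousLinearMap.adjoint A ∘L A : E →L[ℂ] E) : Module.End ℂ E)).subset ?_
      rintro _ ⟨s, hs, rfl⟩
      exact hs.2
    · intro s hs t ht h
      have h' : s ^ 2 = t ^ 2 := by
        have h1 : (s : ℂ) ^ 2 = (t : ℂ) ^ 2 := h
        exact_mod_cast h1
      exact (pow_left_inj₀ hs.1 ht.1 two_ne_zero).1 h'
  have hne : (singularValueSet A).Nonempty := by
    obtain ⟨μ, hμ⟩ := Module.End.exists_eigenvalue
      ((ContinuousLinearMap.adjoint A ∘L A : E →L[ℂ] E) : Module.End ℂ E)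
    obtain ⟨v, hv⟩ := hμ.exists_hasEigenvector
    have hv0 : ‖v‖ ≠ 0 := norm_ne_zero_iff.2 hv.2
    have h1 : ContinuousLinearMap.adjoint A (A v) = μ • v := hv.apply_eq_smul
    have h2 : inner ℂ v (ContinuousLinearMap.adjoint A (A v)) = ((‖A v‖ : ℝ) : ℂ) ^ 2 := by
      rw [ContinuousLinearMap.adjoint_inner_right]
      exact inner_self_eq_norm_sq_to_K (𝕜 := ℂ) (A v)
    have h3 : inner ℂ v v = ((‖v‖ : ℝ) : ℂ) ^ 2 := inner_self_eq_norm_sq_to_K (𝕜 := ℂ) v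
    rw [h1, inner_smul_right, h3] at h2
    have hvc : ((‖v‖ : ℝ) : ℂ) ≠ 0 := by exact_mod_cast hv0
    have hμ' : ((‖A v‖ / ‖v‖ : ℝ) : ℂ) ^ 2 = μ := by
      push_cast
      rw [div_pow, ← h2]
      field_simp
    exact ⟨‖A v‖ / ‖v‖, by positivity, by rw [hμ']; exact hμ⟩
  exact ⟨hne.csInf_mem hfin, fun s hs => csInf_le hfin.bddBelow hs⟩

end SingularValues

end

end Superres

namespace Superres

/-! ### Rayleigh quotients and the least singular value -/

section Rayleigh

variable {E F : Type*}
  [NormedAddCommGroup E] [InnerProductSpace ℂ E] [CompleteSpace E]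
  [NormedAddCommGroup F] [InnerProductSpace ℂ F] [CompleteSpace F]

/-! A vector in `ℂ^T` is the coefficient vector of a polynomial `p` of degree at most `n`, and `‖A_T
x‖²` is the mean of `|p|²` over the arc `|θ| ≤ πy` (`norm_matA_coeffVec_sq`). So `σ_min` measures
how small `p` can be on the arc relative to its coefficients.

Upper bound: the Chebyshev polynomial of the arc is bounded by `1` there, while its leading
coefficient has modulus at least `c⁻ⁿ / 2`. This gives the constant `2`.

Lower bound: Lagrange interpolation at `n + 1` equally spaced points of the arc controls the
coefficients by the sampled values (`norm_coeffVec_sq_le`). Averaging over translates of the nodes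
turns the samples into the integral over the arc (`sum_integral_arcNode`). Stirling's bound and `e ≤
2√2` absorb the factors depending on `n`, leaving the constant `1 / e`. -/

theorem exists_norm_apply_eq_sigmaMin [FiniteDimensional ℂ E] [Nontrivial E] (A : E →L[ℂ] F) :
    ∃ v : E, v ≠ 0 ∧ ‖A v‖ = sigmaMin A * ‖v‖ := by
  obtain ⟨h0, hev⟩ := (isLeast_sigmaMin A).1
  obtain ⟨v, hv⟩ := hev.exists_hasEigenvector
  refine ⟨v, hv.2, ?_⟩
  have h1 : ContinuousLinearMap.adjoint A (A v) = ((sigmaMin A : ℂ) ^ 2) • v :=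
    hv.apply_eq_smul
  have h2 : inner ℂ v (ContinuousLinearMap.adjoint A (A v)) = ((‖A v‖ : ℝ) : ℂ) ^ 2 := by
    rw [ContinuousLinearMap.adjoint_inner_right]
    exact inner_self_eq_norm_sq_to_K (𝕜 := ℂ) (A v)
  have h3 : inner ℂ v v = ((‖v‖ : ℝ) : ℂ) ^ 2 := inner_self_eq_norm_sq_to_K (𝕜 := ℂ) v
  rw [h1, inner_smul_right, h3] at h2
  have h4 : (sigmaMin A * ‖v‖) ^ 2 = ‖A v‖ ^ 2 := by
    rw [mul_pow]
    exact_mod_cast h2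
  exact ((pow_left_inj₀ (by positivity) (by positivity) two_ne_zero).1 h4).symm

theorem sigmaMin_mul_norm_le [FiniteDimensional ℂ E] [Nontrivial E] (A : E →L[ℂ] F) (x : E) :
    sigmaMin A * ‖x‖ ≤ ‖A x‖ := by
  rcases eq_or_ne x 0 with rfl | hx
  · simp
  have hxpos : 0 < ‖x‖ := norm_pos_iff.2 hx
  set B : E →ₗ[ℂ] E := ((ContinuousLinearMap.adjoint A ∘L A : E →L[ℂ] E) : E →ₗ[ℂ] E) with hB
  have hinner (v : E) : RCLike.re (inner ℂ (B v) v) = ‖A v‖ ^ 2 := by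
    change RCLike.re (inner ℂ (ContinuousLinearMap.adjoint A (A v)) v) = _
    rw [ContinuousLinearMap.adjoint_inner_left]
    exact inner_self_eq_norm_sq (𝕜 := ℂ) (A v)
  have hsymm : B.IsSymmetric := fun v w => by
    change inner ℂ (ContinuousLinearMap.adjoint A (A v)) w
      = inner ℂ v (ContinuousLinearMap.adjoint A (A w))
    rw [ContinuousLinearMap.adjoint_inner_left, ContinuousLinearMap.adjoint_inner_right]
  -- In finite dimension the infimum of the Rayleigh quotient of `A* A` is an eigenvalue, so its
  -- root is a singular value.
  have hev := hsymm.hasEigenvalue_iInf_of_finiteDimensional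
  simp only [hinner] at hev
  set m : ℝ := ⨅ v : { v : E // v ≠ 0 }, ‖A v‖ ^ 2 / ‖(v : E)‖ ^ 2 with hm
  have hm0 : 0 ≤ m := Real.iInf_nonneg fun v => by positivity
  have hmem : Real.sqrt m ∈ singularValueSet A := by
    refine ⟨Real.sqrt_nonneg _, ?_⟩
    have h : ((Real.sqrt m : ℝ) : ℂ) ^ 2 = (m : ℂ) := by
      exact_mod_cast Real.sq_sqrt hm0
    rw [h]
    exact hev
  have hle : m ≤ ‖A x‖ ^ 2 / ‖x‖ ^ 2 :=
    ciInf_le (f := fun v : { v : E // v ≠ 0 } => ‖A v‖ ^ 2 / ‖(v : E)‖ ^ 2)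
      ⟨0, by rintro _ ⟨v, rfl⟩; positivity⟩ ⟨x, hx⟩
  calc sigmaMin A * ‖x‖ ≤ Real.sqrt m * ‖x‖ := by
        gcongr
        exact (isLeast_sigmaMin A).2 hmem
    _ ≤ (‖A x‖ / ‖x‖) * ‖x‖ := by
        gcongr
        rw [← div_pow] at hle
        exact Real.sqrt_le_iff.2 ⟨by positivity, hle⟩
    _ = ‖A x‖ := by field_simp

end Rayleigh

/-! ### Coefficient vectors of polynomials -/

open Polynomial

/-- The vector of coefficients of `p` in degrees `0, …, n`. -/
noncomputable def coeffVec (n : ℕ) (p : ℂ[X]) :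
    EuclideanSpace ℂ (Finset.Icc (0 : ℤ) (n : ℤ)) :=
  WithLp.toLp 2 fun j => p.coeff (j : ℤ).toNat

theorem sum_Icc_zero_natCast {M : Type*} [AddCommMonoid M] (n : ℕ) (f : ℤ → M) :
    ∑ j : Finset.Icc (0 : ℤ) (n : ℤ), f j = ∑ i ∈ Finset.range (n + 1), f i := by
  rw [Finset.sum_coe_sort (Finset.Icc (0 : ℤ) n) f]
  symm
  refine Finset.sum_bij (fun i _ => (i : ℤ)) ?_ ?_ ?_ ?_
  · intro i hi
    simp only [Finset.mem_range, Finset.mem_Icc] at *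
    omega
  · intro i _ j _ h
    exact_mod_cast h
  · intro j hj
    simp only [Finset.mem_Icc] at hj
    exact ⟨j.toNat, by simp only [Finset.mem_range]; omega, by omega⟩
  · intro i _
    rfl

theorem exists_coeffVec_eq (n : ℕ) (x : EuclideanSpace ℂ (Finset.Icc (0 : ℤ) (n : ℤ))) :
    ∃ p : ℂ[X], p.natDegree ≤ n ∧ coeffVec n p = x := by
  let a : ℕ → ℂ := fun i => if h : (i : ℤ) ∈ Finset.Icc (0 : ℤ) (n : ℤ) then x ⟨i, h⟩ else 0
  refine ⟨∑ i ∈ Finset.range (n + 1), C (a i) * X ^ i, ?_, ?_⟩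
  · refine natDegree_sum_le_of_forall_le _ _ fun i hi => ?_
    exact (natDegree_C_mul_X_pow_le _ _).trans (by simp only [Finset.mem_range] at hi; omega)
  · ext ⟨j, hj⟩
    have hj' := Finset.mem_Icc.1 hj
    lift j to ℕ using hj'.1
    have hjn : j ≤ n := by omega
    simp [coeffVec, finsetSum_coeff, coeff_C_mul, coeff_X_pow, hjn, a]

theorem norm_coeffVec_sq (n : ℕ) (p : ℂ[X]) :
    ‖coeffVec n p‖ ^ 2 = ∑ i ∈ Finset.range (n + 1), ‖p.coeff i‖ ^ 2 := by
  rw [EuclideanSpace.norm_sq_eq]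
  simpa [coeffVec] using sum_Icc_zero_natCast n fun j : ℤ => ‖p.coeff j.toNat‖ ^ 2

theorem norm_toLp_two_sq {α : Type*} [MeasurableSpace α] {μ : Measure α} {f : α → ℂ}
    (hf : MemLp f 2 μ) : ‖hf.toLp f‖ ^ 2 = ∫ t, ‖f t‖ ^ 2 ∂μ := by
  have h := L2.inner_def (𝕜 := ℂ) (hf.toLp f) (hf.toLp f)
  rw [inner_self_eq_norm_sq_to_K] at h
  have h2 : ∫ t, inner ℂ (hf.toLp f t) (hf.toLp f t) ∂μ = ∫ t, ((‖f t‖ ^ 2 : ℝ) : ℂ) ∂μ := by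
    refine integral_congr_ae ?_
    filter_upwards [hf.coeFn_toLp] with t ht
    rw [ht, inner_self_eq_norm_sq_to_K]
    simp
  rw [h2, integral_complex_ofReal] at h
  refine Complex.ofReal_injective ?_
  rw [Complex.ofReal_pow]
  exact h

theorem norm_matA_coeffVec_sq {y : ℝ} (hy : 0 < y) {n : ℕ} {p : ℂ[X]} (hp : p.natDegree ≤ n) :
    ‖matA y (Finset.Icc (0 : ℤ) (n : ℤ)) (coeffVec n p)‖ ^ 2
      = (2 * Real.pi * y)⁻¹ * ∫ t in (-(Real.pi * y))..(Real.pi * y),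
          ‖p.eval (Complex.exp (t * Complex.I))‖ ^ 2 := by
  have hpi := Real.pi_pos
  have hpos : 0 < 2 * Real.pi * y := by positivity
  have hmem (j : ℤ) := (memLp_atomFun y j)
  have hsum : MemLp (∑ i ∈ Finset.range (n + 1), p.coeff i • atomFun y (i : ℤ)) 2
      (volume.restrict (band y)) :=
    memLp_finsetSum' _ fun i _ => (hmem i).const_smul _
  have h1 : matA y (Finset.Icc (0 : ℤ) (n : ℤ)) (coeffVec n p) = hsum.toLp _ := by
    rw [matA_apply]
    have h := sum_Icc_zero_natCast n fun j : ℤ => p.coeff j.toNat • atom y j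
    simp only [Int.toNat_natCast] at h
    simp only [coeffVec]
    rw [h]
    -- Quantifying over the membership proof lets the induction supply its own for each partial sum.
    have hgen : ∀ s : Finset ℕ, ∀ hs : MemLp (∑ i ∈ s, p.coeff i • atomFun y (i : ℤ)) 2
        (volume.restrict (band y)),
        ∑ i ∈ s, p.coeff i • atom y (i : ℤ) = hs.toLp _ := by
      intro s
      induction s using Finset.induction_on with
      | empty => intro hs; exact (MemLp.toLp_zero hs).symm
      | insert a s ha ih =>
        intro hs
        have hs' : MemLp (∑ i ∈ s, p.coeff i • atomFun y (i : ℤ)) 2 (volume.restrict (band y)) :=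
          memLp_finsetSum' _ fun i _ => (hmem i).const_smul _
        rw [Finset.sum_insert ha, ih hs', atom, ← MemLp.toLp_const_smul, ← MemLp.toLp_add]
        congr 1
        rw [Finset.sum_insert ha]
    exact hgen _ hsum
  rw [h1, norm_toLp_two_sq, band, integral_Icc_eq_integral_Ioc,
    ← intervalIntegral.integral_of_le (by nlinarith [mul_pos hpi hy]),
    ← intervalIntegral.integral_const_mul]
  refine intervalIntegral.integral_congr fun t _ => ?_
  have h2 : (∑ i ∈ Finset.range (n + 1), p.coeff i • atomFun y (i : ℤ)) t
      = p.eval (Complex.exp (t * Complex.I)) / (Real.sqrt (2 * Real.pi * y) : ℂ) := by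
    rw [eval_eq_sum_range' (Nat.lt_succ_of_le hp), Finset.sum_apply, Finset.sum_div]
    refine Finset.sum_congr rfl fun i _ => ?_
    simp only [Pi.smul_apply, smul_eq_mul, atomFun, ← Complex.exp_nat_mul, mul_div_assoc]
    congr 3
    push_cast
    ring
  simp only [h2, norm_div, div_pow, Complex.norm_real, Real.norm_eq_abs, sq_abs]
  rw [Real.sq_sqrt hpos.le]
  ring

/-! ### Chebyshev polynomials of a circular arc -/

/-- The polynomial of degree `n` whose value at `e^{iθ}` is
`e^{inθ/2} T_n(sin (θ/2) / c)`, with `T_n` the Chebyshev polynomial of the first kind. -/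
noncomputable def arcChebyshev (c : ℂ) : ℕ → ℂ[X]
  | 0 => 1
  | 1 => C (2 * Complex.I * c)⁻¹ * (X - 1)
  | n + 2 => C (Complex.I * c)⁻¹ * (X - 1) * arcChebyshev c (n + 1) - X * arcChebyshev c n

theorem natDegree_arcChebyshev_le (c : ℂ) (n : ℕ) : (arcChebyshev c n).natDegree ≤ n := by
  induction n using Nat.twoStepInduction with
  | zero => simp [arcChebyshev]
  | one =>
    refine (natDegree_C_mul_le _ _).trans ?_
    exact (natDegree_X_sub_C (1 : ℂ)).le
  | more n ih1 ih2 =>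
    refine (natDegree_sub_le _ _).trans (max_le ?_ ?_)
    · refine natDegree_mul_le.trans ?_
      have h : (C (Complex.I * c)⁻¹ * (X - 1) : ℂ[X]).natDegree ≤ 1 :=
        (natDegree_C_mul_le _ _).trans (natDegree_X_sub_C (1 : ℂ)).le
      omega
    · refine natDegree_mul_le.trans ?_
      have h : (X : ℂ[X]).natDegree ≤ 1 := natDegree_X_le
      omega

theorem coeff_arcChebyshev_self (c : ℂ) (n : ℕ) :
    (arcChebyshev c (n + 1)).coeff (n + 1) = (1 / 2) * ((Complex.I * c)⁻¹) ^ (n + 1) := by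
  induction n with
  | zero =>
    rw [arcChebyshev, coeff_C_mul, coeff_sub, zero_add, coeff_X_one, coeff_one, if_neg one_ne_zero,
      mul_assoc 2, mul_inv]
    ring
  | succ n ih =>
    have h1 : (arcChebyshev c (n + 1)).coeff (n + 2) = 0 :=
      coeff_eq_zero_of_natDegree_lt ((natDegree_arcChebyshev_le c (n + 1)).trans_lt (by omega))
    have h2 : (arcChebyshev c n).coeff (n + 1) = 0 :=
      coeff_eq_zero_of_natDegree_lt ((natDegree_arcChebyshev_le c n).trans_lt (by omega))
    rw [arcChebyshev, coeff_sub, coeff_X_mul, h2, mul_assoc, coeff_C_mul, sub_mul, coeff_sub,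
      coeff_X_mul, one_mul, h1, ih]
    ring

/-- With `w = e^{it/2}` one has `w² - 1 = 2i w sin (t/2)`, so the defining recurrence is `T_{n+2} =
2x T_{n+1} - T_n` at `x = sin (t/2) / c`, multiplied by `w^{n+2}`. -/
theorem eval_arcChebyshev {c : ℝ} (hc : c ≠ 0) (t : ℝ) (n : ℕ) :
    (arcChebyshev c n).eval (Complex.exp (t * Complex.I))
      = Complex.exp ((t / 2 : ℝ) * Complex.I) ^ n
        * ((Chebyshev.T ℝ n).eval (Real.sin (t / 2) / c) : ℝ) := by
  set w := Complex.exp ((t / 2 : ℝ) * Complex.I) with hw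
  have hz : Complex.exp (t * Complex.I) = w ^ 2 := by
    rw [hw, ← Complex.exp_nat_mul]
    congr 1
    push_cast
    ring
  have hcc : (c : ℂ) ≠ 0 := by exact_mod_cast hc
  have hs : w ^ 2 - 1 = 2 * Complex.I * w * (Real.sin (t / 2) : ℝ) := by
    have h1 : w = Complex.cos (t / 2 : ℝ) + Complex.sin (t / 2 : ℝ) * Complex.I :=
      Complex.exp_mul_I _
    rw [h1, Complex.ofReal_sin]
    linear_combination Complex.sin_sq_add_cos_sq (t / 2 : ℝ)
      - Complex.sin (t / 2 : ℝ) ^ 2 * Complex.I_sq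
  rw [hz]
  induction n using Nat.twoStepInduction with
  | zero => simp [arcChebyshev]
  | one =>
    simp only [arcChebyshev, eval_mul, eval_C, eval_sub, eval_X, eval_one, hs]
    simp only [Nat.cast_one, Chebyshev.T_one, eval_X, pow_one]
    push_cast
    field_simp
  | more n ih1 ih2 =>
    rw [arcChebyshev]
    simp only [eval_mul, eval_C, eval_sub, eval_X, eval_one, hs, ih1, ih2]
    have h := Chebyshev.T_add_two ℝ (n : ℤ)
    rw [Nat.cast_add n 2, Nat.cast_add n 1, Nat.cast_one, Nat.cast_two, h]
    simp only [eval_sub, eval_mul, eval_X, eval_ofNat, Complex.ofReal_sub, Complex.ofReal_mul,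
      Complex.ofReal_div, Complex.ofReal_ofNat]
    field_simp
    ring

theorem norm_eval_arcChebyshev_le {α t : ℝ} (hα : 0 < Real.sin (α / 2)) (hα' : α ≤ Real.pi)
    (ht : |t| ≤ α) (n : ℕ) :
    ‖(arcChebyshev (Real.sin (α / 2) : ℝ) n).eval (Complex.exp (t * Complex.I))‖ ≤ 1 := by
  rw [eval_arcChebyshev hα.ne', norm_mul, norm_pow, Complex.norm_exp_ofReal_mul_I, one_pow,
    one_mul, Complex.norm_real, Real.norm_eq_abs]
  refine Chebyshev.abs_eval_T_real_le_one _ ?_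
  rw [abs_div, abs_of_pos hα, div_le_one hα, abs_le]
  obtain ⟨h1, h2⟩ := abs_le.1 ht
  constructor
  · rw [← Real.sin_neg]
    exact Real.sin_le_sin_of_le_of_le_pi_div_two (by linarith) (by linarith) (by linarith)
  · exact Real.sin_le_sin_of_le_of_le_pi_div_two (by linarith) (by linarith) (by linarith)

/-! ### The upper bound -/

instance nontrivial_euclideanSpace_Icc (n : ℕ) :
    Nontrivial (EuclideanSpace ℂ (Finset.Icc (0 : ℤ) (n : ℤ))) := by
  have : Nonempty (Finset.Icc (0 : ℤ) (n : ℤ)) := ⟨⟨0, by simp⟩⟩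
  infer_instance

theorem norm_coeff_le_norm_coeffVec (n : ℕ) (p : ℂ[X]) : ‖p.coeff n‖ ≤ ‖coeffVec n p‖ := by
  refine (pow_le_pow_iff_left₀ (norm_nonneg _) (norm_nonneg _) two_ne_zero).1 ?_
  rw [norm_coeffVec_sq]
  exact Finset.single_le_sum (f := fun i => ‖p.coeff i‖ ^ 2) (fun i _ => by positivity)
    (Finset.self_mem_range_succ n)

theorem norm_coeff_arcChebyshev_ge {c : ℝ} (hc : 0 < c) (n : ℕ) :
    1 / 2 * (c⁻¹) ^ n ≤ ‖(arcChebyshev c n).coeff n‖ := by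
  cases n with
  | zero => norm_num [arcChebyshev]
  | succ n =>
    rw [coeff_arcChebyshev_self]
    simp [abs_of_pos hc]

theorem sin_half_pos {y : ℝ} (hy : 0 < y) (hy' : y < 1 / 2) : 0 < Real.sin (Real.pi * y / 2) := by
  have hpi := Real.pi_pos
  exact Real.sin_pos_of_pos_of_lt_pi (by positivity) (by nlinarith)

theorem sigmaMin_matA_le {y : ℝ} (hy : 0 < y) (hy' : y < 1 / 2) (n : ℕ) :
    sigmaMin (matA y (Finset.Icc (0 : ℤ) (n : ℤ))) ≤ 2 * Real.sin (Real.pi * y / 2) ^ n := by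
  have hpi := Real.pi_pos
  have hc := sin_half_pos hy hy'
  set c := Real.sin (Real.pi * y / 2) with hcdef
  set p := arcChebyshev c n with hp
  have h1 : ‖matA y (Finset.Icc (0 : ℤ) (n : ℤ)) (coeffVec n p)‖ ^ 2 ≤ 1 := by
    rw [norm_matA_coeffVec_sq hy (natDegree_arcChebyshev_le _ n)]
    have hle : ∫ t in (-(Real.pi * y))..(Real.pi * y),
        ‖p.eval (Complex.exp (t * Complex.I))‖ ^ 2
          ≤ ∫ t in (-(Real.pi * y))..(Real.pi * y), (1 : ℝ) := by
      refine intervalIntegral.integral_mono_on (by nlinarith [mul_pos hpi hy])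
        (Continuous.intervalIntegrable (by fun_prop) _ _)
        (Continuous.intervalIntegrable (by fun_prop) _ _) fun t ht => ?_
      exact pow_le_one₀ (norm_nonneg _)
        (norm_eval_arcChebyshev_le hc (by nlinarith) (abs_le.2 ht) n)
    calc _ ≤ (2 * Real.pi * y)⁻¹ * ∫ t in (-(Real.pi * y))..(Real.pi * y), (1 : ℝ) := by gcongr
      _ = 1 := by
        rw [intervalIntegral.integral_const]
        simp only [smul_eq_mul]
        field_simp
        ring
  have h2 : ‖matA y (Finset.Icc (0 : ℤ) (n : ℤ)) (coeffVec n p)‖ ≤ 1 :=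
    (sq_le_one_iff₀ (norm_nonneg _)).1 h1
  have h3 := sigmaMin_mul_norm_le (matA y (Finset.Icc (0 : ℤ) (n : ℤ))) (coeffVec n p)
  have h4 : 1 / 2 * (c⁻¹) ^ n ≤ ‖coeffVec n p‖ :=
    (norm_coeff_arcChebyshev_ge hc n).trans (norm_coeff_le_norm_coeffVec n p)
  have h5 : 0 ≤ sigmaMin (matA y (Finset.Icc (0 : ℤ) (n : ℤ))) := (isLeast_sigmaMin _).1.1
  have h6 := ((mul_le_mul_of_nonneg_left h4 h5).trans h3).trans h2
  rw [inv_pow, one_div, ← mul_inv, ← div_eq_mul_inv, div_le_one (by positivity)] at h6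
  exact h6

/-! ### Interpolation at equally spaced nodes -/

/-- Up to sign the coefficients are elementary symmetric functions of numbers in the unit disc; the
induction is Pascal's rule. -/
theorem norm_coeff_prod_X_sub_C_le {ι : Type*} (s : Finset ι) (v : ι → ℂ)
    (hv : ∀ i, ‖v i‖ ≤ 1) (j : ℕ) :
    ‖(∏ i ∈ s, (X - C (v i))).coeff j‖ ≤ (s.card.choose j : ℝ) := by
  classical
  induction s using Finset.induction_on generalizing j with
  | empty => cases j <;> simp [coeff_one]
  | insert a s ha ih =>
    rw [Finset.prod_insert ha, Finset.card_insert_of_notMem ha, sub_mul, coeff_sub, coeff_C_mul]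
    have hmul (i : ℕ) : ‖v a * (∏ i ∈ s, (X - C (v i))).coeff i‖ ≤ (s.card.choose i : ℝ) := by
      rw [norm_mul]
      exact (mul_le_of_le_one_left (norm_nonneg _) (hv a)).trans (ih i)
    cases j with
    | zero => simpa using hmul 0
    | succ j =>
      rw [coeff_X_mul, Nat.choose_succ_succ, Nat.cast_add]
      exact (norm_sub_le _ _).trans (add_le_add (ih j) (hmul (j + 1)))

theorem prod_range_erase_abs_sub (k m : ℕ) :
    ∏ j ∈ (Finset.range (k + m + 1)).erase k, |(k : ℝ) - j| = (k.factorial * m.factorial : ℝ) := by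
  induction m with
  | zero =>
    rw [add_zero, Finset.range_add_one, Finset.erase_insert (by simp), Nat.factorial_zero,
      Nat.cast_one, mul_one, ← Nat.descFactorial_self, Nat.descFactorial_eq_prod_range,
      Nat.cast_prod]
    refine Finset.prod_congr rfl fun j hj => ?_
    have hjk := (Finset.mem_range.1 hj).le
    rw [Nat.cast_sub hjk, abs_of_nonneg (by simpa using hjk)]
  | succ m ih =>
    rw [← add_assoc, Finset.range_add_one, Finset.erase_insert_of_ne (by omega),
      Finset.prod_insert (by simp), ih, Nat.factorial_succ]
    have h : |(k : ℝ) - ((k + m + 1 : ℕ) : ℝ)| = (m + 1 : ℕ) := by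
      push_cast
      rw [show (k : ℝ) - (k + m + 1) = -(m + 1) by ring, abs_neg, abs_of_nonneg (by positivity)]
    rw [h]
    push_cast
    ring

/-- The numerator contributes `n.choose i`. By separation the denominator is at least `δⁿ k! (n -
k)!`, whose inverse is `n.choose k / (δⁿ n!)`. -/
theorem norm_coeff_basis_le {n k : ℕ} (hk : k ≤ n) {v : ℕ → ℂ} (hv : ∀ i, ‖v i‖ ≤ 1) {δ : ℝ}
    (hδ : 0 < δ) (hsep : ∀ j ≤ n, δ * |(k : ℝ) - j| ≤ ‖v k - v j‖) (i : ℕ) :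
    ‖(Lagrange.basis (Finset.range (n + 1)) v k).coeff i‖
      ≤ (n.choose i : ℝ) * (n.choose k / (δ ^ n * n.factorial)) := by
  have hmem : k ∈ Finset.range (n + 1) := by simp only [Finset.mem_range]; omega
  have hcard : ((Finset.range (n + 1)).erase k).card = n := by
    rw [Finset.card_erase_of_mem hmem, Finset.card_range, Nat.add_sub_cancel]
  have hfac : (n.choose k : ℝ) * (k.factorial * (n - k).factorial) = n.factorial := by
    rw [← mul_assoc]
    exact_mod_cast Nat.choose_mul_factorial_mul_factorial hk
  have hprod : δ ^ n * (k.factorial * (n - k).factorial)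
      ≤ ∏ j ∈ (Finset.range (n + 1)).erase k, ‖v k - v j‖ := by
    have h := prod_range_erase_abs_sub k (n - k)
    rw [Nat.add_sub_cancel' hk] at h
    rw [← h]
    nth_rewrite 1 [← hcard]
    rw [← Finset.prod_const, ← Finset.prod_mul_distrib]
    refine Finset.prod_le_prod (fun j _ => by positivity) fun j hj => hsep j ?_
    have := Finset.mem_range.1 (Finset.mem_of_mem_erase hj)
    omega
  have hfpos : 0 < δ ^ n * ((k.factorial : ℝ) * (n - k).factorial) := by positivity
  have hch : (n.choose k : ℝ) ≠ 0 := by exact_mod_cast (Nat.choose_pos hk).ne'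
  have hinv : ‖∏ j ∈ (Finset.range (n + 1)).erase k, (v k - v j)⁻¹‖
      ≤ n.choose k / (δ ^ n * n.factorial) := by
    rw [Finset.prod_inv_distrib, norm_inv, norm_prod]
    calc _ ≤ (δ ^ n * ((k.factorial : ℝ) * (n - k).factorial))⁻¹ := by gcongr
      _ = _ := by
        rw [← hfac]
        field_simp
  have hbasis : Lagrange.basis (Finset.range (n + 1)) v k
      = C (∏ j ∈ (Finset.range (n + 1)).erase k, (v k - v j)⁻¹)
        * ∏ j ∈ (Finset.range (n + 1)).erase k, (X - C (v j)) := by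
    rw [Lagrange.basis, map_prod, ← Finset.prod_mul_distrib]
    rfl
  have hX := norm_coeff_prod_X_sub_C_le ((Finset.range (n + 1)).erase k) v hv i
  rw [hcard] at hX
  rw [hbasis, coeff_C_mul, norm_mul, mul_comm]
  gcongr

theorem sum_range_choose_sq_le (n : ℕ) :
    ∑ i ∈ Finset.range (n + 1), (n.choose i : ℝ) ^ 2 ≤ ((2 : ℝ) ^ n) ^ 2 := by
  have h : (∑ i ∈ Finset.range (n + 1), (n.choose i : ℝ)) = 2 ^ n := by
    exact_mod_cast Nat.sum_range_choose n
  rw [← h]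
  exact Finset.sum_sq_le_sq_sum_of_nonneg fun i _ => by positivity

theorem norm_coeffVec_sq_le {n : ℕ} {p : ℂ[X]} (hp : p.natDegree ≤ n) {v : ℕ → ℂ}
    (hv : ∀ i, ‖v i‖ ≤ 1) {δ : ℝ} (hδ : 0 < δ)
    (hsep : ∀ k ≤ n, ∀ j ≤ n, δ * |(k : ℝ) - j| ≤ ‖v k - v j‖) :
    ‖coeffVec n p‖ ^ 2 ≤ ((4 / δ) ^ n / n.factorial) ^ 2
      * ∑ k ∈ Finset.range (n + 1), ‖p.eval (v k)‖ ^ 2 := by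
  have hinj : Set.InjOn v (Finset.range (n + 1)) := by
    intro k hk j hj hkj
    have hk' : k ≤ n := by simp at hk; omega
    have hj' : j ≤ n := by simp at hj; omega
    have h := hsep k hk' j hj'
    rw [hkj, sub_self, norm_zero] at h
    have h2 : |(k : ℝ) - j| ≤ 0 := nonpos_of_mul_nonpos_right h hδ
    have h3 := abs_nonpos_iff.1 h2
    exact_mod_cast sub_eq_zero.1 h3
  have hdeg : p.degree < (Finset.range (n + 1)).card := by
    rw [Finset.card_range]
    exact degree_le_natDegree.trans_lt (by exact_mod_cast Nat.lt_succ_of_le hp)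
  have hpeq := Lagrange.eq_interpolate hinj hdeg
  set S := ∑ k ∈ Finset.range (n + 1), (n.choose k : ℝ) * ‖p.eval (v k)‖ with hS
  -- Cauchy–Schwarz over the nodes costs one factor `2ⁿ`; summing over the coefficients costs
  -- another, whence `4ⁿ`.
  have hS2 : S ^ 2 ≤ ((2 : ℝ) ^ n) ^ 2 * ∑ k ∈ Finset.range (n + 1), ‖p.eval (v k)‖ ^ 2 :=
    (Finset.sum_mul_sq_le_sq_mul_sq _ _ _).trans
      (mul_le_mul_of_nonneg_right (sum_range_choose_sq_le n)
        (Finset.sum_nonneg fun _ _ => by positivity))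
  have hcoeff (i : ℕ) : ‖p.coeff i‖ ≤ (n.choose i : ℝ) * (S / (δ ^ n * n.factorial)) := by
    conv_lhs => rw [hpeq]
    rw [Lagrange.interpolate_apply, finsetSum_coeff, hS, Finset.sum_div, Finset.mul_sum]
    refine norm_sum_le_of_le _ fun k hk => ?_
    have hk' : k ≤ n := by have := Finset.mem_range.1 hk; omega
    rw [coeff_C_mul, norm_mul]
    calc _ ≤ ‖p.eval (v k)‖ * ((n.choose i : ℝ) * (n.choose k / (δ ^ n * n.factorial))) := by
          gcongr
          exact norm_coeff_basis_le hk' hv hδ (hsep k hk') i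
      _ = _ := by ring
  rw [norm_coeffVec_sq]
  calc ∑ i ∈ Finset.range (n + 1), ‖p.coeff i‖ ^ 2
      ≤ ∑ i ∈ Finset.range (n + 1), ((n.choose i : ℝ) * (S / (δ ^ n * n.factorial))) ^ 2 := by
        gcongr with i
        exact hcoeff i
    _ = (∑ i ∈ Finset.range (n + 1), (n.choose i : ℝ) ^ 2) * (S ^ 2 / (δ ^ n * n.factorial) ^ 2) := by
        simp only [mul_pow, div_pow, Finset.sum_mul]
    _ ≤ ((2 : ℝ) ^ n) ^ 2 * (((2 : ℝ) ^ n) ^ 2 * (∑ k ∈ Finset.range (n + 1), ‖p.eval (v k)‖ ^ 2)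
          / (δ ^ n * n.factorial) ^ 2) := by
        gcongr
        exact sum_range_choose_sq_le n
    _ = _ := by
        rw [show (4 : ℝ) = 2 * 2 by norm_num, div_pow (2 * 2 : ℝ), mul_pow (2 : ℝ)]
        ring

/-! ### Node separation and averaging over translates -/

theorem mul_sin_le_sin_mul {α t : ℝ} (hα : 0 ≤ α) (hα' : α ≤ Real.pi) (ht : 0 ≤ t) (ht' : t ≤ 1) :
    t * Real.sin α ≤ Real.sin (t * α) := by
  have h := strictConcaveOn_sin_Icc.concaveOn.2 (x := 0) (y := α) ⟨le_rfl, Real.pi_pos.le⟩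
    ⟨hα, hα'⟩ (sub_nonneg.2 ht') ht (by ring)
  simpa using h

theorem sqrt_two_mul_sin_half_le {α : ℝ} (hα : 0 ≤ α) (hα' : α ≤ Real.pi / 2) :
    √2 * Real.sin (α / 2) ≤ Real.sin α := by
  have hs : 0 ≤ Real.sin (α / 2) :=
    Real.sin_nonneg_of_nonneg_of_le_pi (by linarith) (by linarith [Real.pi_pos])
  have hcos : √2 / 2 ≤ Real.cos (α / 2) := by
    rw [← Real.cos_pi_div_four]
    exact Real.cos_le_cos_of_nonneg_of_le_pi (by linarith) (by linarith [Real.pi_pos])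
      (by linarith)
  have h : Real.sin α = 2 * Real.sin (α / 2) * Real.cos (α / 2) := by
    rw [← Real.sin_two_mul]
    ring_nf
  rw [h]
  nlinarith [mul_le_mul_of_nonneg_left hcos hs]

theorem norm_exp_sub_exp (s t : ℝ) :
    ‖Complex.exp (s * Complex.I) - Complex.exp (t * Complex.I)‖ = 2 * |Real.sin ((s - t) / 2)| := by
  have h : Complex.exp (s * Complex.I) - Complex.exp (t * Complex.I)
      = Complex.exp (t * Complex.I) * (Complex.exp (Complex.I * (s - t : ℝ)) - 1) := by
    rw [mul_sub, ← Complex.exp_add, mul_one]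
    congr 2
    push_cast
    ring
  rw [h, norm_mul, Complex.norm_exp_ofReal_mul_I, one_mul, Complex.norm_exp_I_mul_ofReal_sub_one]
  simp

/-- The `k`-th of `n + 1` equally spaced nodes of spacing `2α / (n + 1)` in `[-α, α]`, at relative
position `t` in its cell. -/
noncomputable def arcNode (α : ℝ) (n : ℕ) (t : ℝ) (k : ℕ) : ℝ :=
  2 * α / (n + 1) * t + (-α + 2 * α / (n + 1) * k)

/-- The chord is `2 |sin ((k - j) α / (n + 1))|`. Concavity of sine extracts the factor `|k - j| /
(n + 1)`, and `α ≤ π/2` gives `sin α ≥ √2 sin (α/2)`. -/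
theorem arcNode_separated {α : ℝ} (hα : 0 ≤ α) (hα' : α ≤ Real.pi / 2) (n : ℕ) (t : ℝ)
    {k j : ℕ} (hk : k ≤ n) (hj : j ≤ n) :
    2 * √2 * Real.sin (α / 2) / (n + 1) * |(k : ℝ) - j|
      ≤ ‖Complex.exp (arcNode α n t k * Complex.I)
        - Complex.exp (arcNode α n t j * Complex.I)‖ := by
  rw [norm_exp_sub_exp]
  have hhalf : (arcNode α n t k - arcNode α n t j) / 2 = ((k : ℝ) - j) / (n + 1) * α := by
    unfold arcNode
    ring
  have hd : |(k : ℝ) - j| ≤ n + 1 := by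
    have h1 : (k : ℝ) ≤ n := by exact_mod_cast hk
    have h2 : (j : ℝ) ≤ n := by exact_mod_cast hj
    rw [abs_le]
    constructor <;> linarith [(Nat.cast_nonneg k : (0 : ℝ) ≤ k), (Nat.cast_nonneg j : (0 : ℝ) ≤ j)]
  have hu : |(k : ℝ) - j| / (n + 1) ≤ 1 := (div_le_one (by positivity)).2 hd
  have hu0 : 0 ≤ |(k : ℝ) - j| / (n + 1) := by positivity
  have habs : |((k : ℝ) - j) / (n + 1) * α| = |(k : ℝ) - j| / (n + 1) * α := by
    rw [abs_mul, abs_div, abs_of_nonneg hα, abs_of_pos (by positivity : (0 : ℝ) < n + 1)]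
  have hsin := mul_sin_le_sin_mul hα (by linarith [Real.pi_pos]) hu0 hu
  have habs2 : Real.sin |((k : ℝ) - j) / (n + 1) * α| ≤ |Real.sin (((k : ℝ) - j) / (n + 1) * α)| := by
    rcases abs_cases (((k : ℝ) - j) / (n + 1) * α) with ⟨h, _⟩ | ⟨h, _⟩
    · rw [h]
      exact le_abs_self _
    · rw [h, Real.sin_neg]
      exact neg_le_abs _
  rw [habs] at habs2
  rw [hhalf]
  have h1 := mul_le_mul_of_nonneg_left (sqrt_two_mul_sin_half_le hα hα') hu0
  calc _ = 2 * (|(k : ℝ) - j| / (n + 1) * (√2 * Real.sin (α / 2))) := by ring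
    _ ≤ _ := by linarith

/-- As `t` runs over `[0, 1]`, the `k`-th node sweeps the `k`-th cell, and the `n + 1` cells tile
`[-α, α]`. -/
theorem sum_integral_arcNode {f : ℝ → ℝ} (hf : Continuous f) {α : ℝ} (hα : 0 < α) (n : ℕ) :
    ∑ k ∈ Finset.range (n + 1), ∫ t in (0 : ℝ)..1, f (arcNode α n t k)
      = (n + 1) * ((2 * α)⁻¹ * ∫ t in (-α)..α, f t) := by
  have hne : (2 * α / (n + 1) : ℝ) ≠ 0 := by positivity
  set a : ℕ → ℝ := fun k => -α + 2 * α / (n + 1) * k with ha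
  have h (k : ℕ) : ∫ t in (0 : ℝ)..1, f (arcNode α n t k)
      = (2 * α / (n + 1))⁻¹ * ∫ t in (a k)..(a (k + 1)), f t := by
    unfold arcNode
    rw [intervalIntegral.integral_comp_mul_add f hne, smul_eq_mul]
    congr 2
    · simp [ha]
    · simp only [ha]
      push_cast
      ring
  have h0 : a 0 = -α := by simp [ha]
  have h1 : a (n + 1) = α := by
    simp only [ha]
    push_cast
    field_simp
    ring
  simp only [h]
  rw [← Finset.mul_sum, intervalIntegral.sum_integral_adjacent_intervals
    (fun k _ => hf.intervalIntegrable _ _), h0, h1]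
  field_simp

theorem norm_coeffVec_sq_le_average {α : ℝ} (hα : 0 < α) (hα' : α ≤ Real.pi / 2) {n : ℕ}
    {p : ℂ[X]} (hp : p.natDegree ≤ n) :
    ‖coeffVec n p‖ ^ 2
      ≤ ((4 / (2 * √2 * Real.sin (α / 2) / (n + 1))) ^ n / n.factorial) ^ 2 * ((n + 1)
        * ((2 * α)⁻¹ * ∫ t in (-α)..α, ‖p.eval (Complex.exp (t * Complex.I))‖ ^ 2)) := by
  have hs : 0 < Real.sin (α / 2) :=
    Real.sin_pos_of_pos_of_lt_pi (by linarith) (by linarith [Real.pi_pos])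
  have hcont : Continuous fun t : ℝ => ‖p.eval (Complex.exp (t * Complex.I))‖ ^ 2 := by fun_prop
  have hnode (k : ℕ) : Continuous fun t : ℝ =>
      ‖p.eval (Complex.exp (arcNode α n t k * Complex.I))‖ ^ 2 := by
    unfold arcNode
    fun_prop
  rw [← sum_integral_arcNode hcont hα n,
    ← intervalIntegral.integral_finsetSum fun k _ => (hnode k).intervalIntegrable _ _,
    ← intervalIntegral.integral_const_mul]
  have hconst : ‖coeffVec n p‖ ^ 2 = ∫ _ in (0 : ℝ)..1, ‖coeffVec n p‖ ^ 2 := by simp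
  rw [hconst]
  refine intervalIntegral.integral_mono_on zero_le_one intervalIntegrable_const
    (Continuous.intervalIntegrable (by fun_prop) _ _) fun t _ => ?_
  exact norm_coeffVec_sq_le hp
    (v := fun k => Complex.exp (arcNode α n t k * Complex.I))
    (fun k => (Complex.norm_exp_ofReal_mul_I _).le) (by positivity)
    fun k hk j hj => arcNode_separated hα.le hα' n t hk hj

/-! ### Stirling's bound and the lower bound -/

theorem succ_pow_mul_sqrt_le (n : ℕ) :
    ((n : ℝ) + 1) ^ n * √(n + 1) ≤ Real.exp 1 * Real.exp 1 ^ n * n.factorial := by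
  -- Stirling is used at `n + 1`, matching the base `n + 1` from the node spacing; one factor `n +
  -- 1` of the factorial cancels.
  have h := Stirling.le_factorial_stirling (n + 1)
  have hs : √((n : ℝ) + 1) ≤ √(2 * Real.pi * (n + 1 : ℕ)) := by
    refine Real.sqrt_le_sqrt ?_
    push_cast
    nlinarith [Real.pi_gt_three, (Nat.cast_nonneg n : (0 : ℝ) ≤ n)]
  have h2 := (mul_le_mul_of_nonneg_right hs
    (by positivity : (0 : ℝ) ≤ ((n + 1 : ℕ) / Real.exp 1) ^ (n + 1))).trans h
  rw [Nat.factorial_succ] at h2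
  push_cast at h2
  rw [div_pow, ← mul_div_assoc, div_le_iff₀ (by positivity)] at h2
  refine le_of_mul_le_mul_left ?_ (by positivity : (0 : ℝ) < n + 1)
  calc _ = √((n : ℝ) + 1) * ((n : ℝ) + 1) ^ (n + 1) := by ring
    _ ≤ _ := h2
    _ = _ := by ring

theorem exp_one_le_two_mul_sqrt_two : Real.exp 1 ≤ 2 * √2 := by
  have h1 := Real.exp_one_lt_d9
  have h2 : (1.4 : ℝ) ≤ √2 := Real.le_sqrt_of_sq_le (by norm_num)
  linarith

theorem le_sigmaMin_matA {y : ℝ} (hy : 0 < y) (hy' : y < 1 / 2) (n : ℕ) :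
    (Real.exp 1)⁻¹ * (Real.sin (Real.pi * y / 2) / 4) ^ n
      ≤ sigmaMin (matA y (Finset.Icc (0 : ℤ) (n : ℤ))) := by
  have hpi := Real.pi_pos
  have hc := sin_half_pos hy hy'
  set c := Real.sin (Real.pi * y / 2) with hcdef
  set A := matA y (Finset.Icc (0 : ℤ) (n : ℤ)) with hA
  obtain ⟨v, hv0, hv⟩ := exists_norm_apply_eq_sigmaMin A
  obtain ⟨p, hp, rfl⟩ := exists_coeffVec_eq n v
  have h1 := norm_coeffVec_sq_le_average (mul_pos hpi hy) (by nlinarith) hp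
  rw [← mul_assoc 2, ← norm_matA_coeffVec_sq hy hp, ← hcdef, ← hA, hv] at h1
  have hvpos : 0 < ‖coeffVec n p‖ := norm_pos_iff.2 hv0
  have hσ : 0 ≤ sigmaMin A := (isLeast_sigmaMin A).1.1
  set K := (4 / (2 * √2 * c / (n + 1))) ^ n / n.factorial * √(n + 1) with hK
  have hK0 : 0 ≤ K := by positivity
  have h2 : 1 ≤ K * sigmaMin A := by
    have h3 : ‖coeffVec n p‖ ^ 2 ≤ (K * sigmaMin A * ‖coeffVec n p‖) ^ 2 := by
      refine h1.trans_eq ?_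
      have hsq : √((n : ℝ) + 1) ^ 2 = n + 1 := Real.sq_sqrt (by positivity)
      rw [mul_assoc K, mul_pow K, hK, mul_pow _ √((n : ℝ) + 1), hsq]
      ring
    have h4 := (pow_le_pow_iff_left₀ hvpos.le (by positivity) two_ne_zero).1 h3
    exact le_of_mul_le_mul_right (by linarith) hvpos
  have hKle : K ≤ Real.exp 1 * (4 / c) ^ n := by
    have h5 : K = (4 / c) ^ n * ((((n : ℝ) + 1) ^ n * √(n + 1)) / ((2 * √2) ^ n * n.factorial)) := by
      rw [hK]
      simp only [div_pow, mul_pow]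
      field_simp
    -- The growth `eⁿ` left by Stirling is absorbed by `(2√2)ⁿ` from the node separation.
    have h6 : (((n : ℝ) + 1) ^ n * √(n + 1)) / ((2 * √2) ^ n * n.factorial) ≤ Real.exp 1 := by
      rw [div_le_iff₀ (by positivity)]
      refine (succ_pow_mul_sqrt_le n).trans ?_
      rw [← mul_assoc]
      gcongr
      exact exp_one_le_two_mul_sqrt_two
    rw [h5, mul_comm]
    gcongr
  have h7 : 1 ≤ Real.exp 1 * (4 / c) ^ n * sigmaMin A :=
    h2.trans (mul_le_mul_of_nonneg_right hKle hσ)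
  have h8 : (Real.exp 1)⁻¹ * (c / 4) ^ n = (Real.exp 1 * (4 / c) ^ n)⁻¹ := by
    rw [mul_inv, ← inv_pow, inv_div]
  rw [h8]
  exact (inv_le_iff_one_le_mul₀' (by positivity)).2 h7

end Superres

theorem mainTheorem4 :
    ∃ C : ℝ, 0 < C ∧ ∀ y : ℝ, 0 < y → y < 1 / 2 → ∀ n : ℕ,
      C * (Real.sin (Real.pi * y / 2) / 4) ^ n
          ≤ Superres.sigmaMin (Superres.matA y (Finset.Icc (0 : ℤ) (n : ℤ))) ∧
        Superres.sigmaMin (Superres.matA y (Finset.Icc (0 : ℤ) (n : ℤ)))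
          ≤ 4 * Real.sin (Real.pi * y / 2) ^ n := by
  refine ⟨(Real.exp 1)⁻¹, by positivity, fun y hy hy' n => ?_⟩
  refine ⟨Superres.le_sigmaMin_matA hy hy' n, (Superres.sigmaMin_matA_le hy hy' n).trans ?_⟩
  have := Superres.sin_half_pos hy hy'
  gcongr
  norm_num
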